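/- Let $H$ be a (real or complex) Hilbert space whose inner product $\langle\cdot,\cdot\rangle$ is linear in the first argument. Let $A$ be the infinitesimal generator of a $C_0$-semigroup $(S(t))_{t\ge 0}$ of contractions on $H$ (that is, $\|S(t)\|\le 1$ for all $t\ge 0$) which is compact, meaning that $S(t)$ is a compact operator for every $t>0$. Let $B$ be a bounded linear operator on $H$ satisfying the weak observability condition $$\langle BS(t)y,S(t)y\rangle=0\ \text{ for all } t\ge 0\ \Longrightarrow\ y=0 .$$ Then the quadratic feedback $v_0(t)=-\langle z(t),Bz(t)\rangle$ strongly stabilizes the bilinear system $\dot z(t)=Az(t)+v(t)Bz(t)$, $z(0)=z_0$. That is, for the closed-loop system $$\dot z(t)=Az(t)-\langle z(t),Bz(t)\rangle Bz(t),\qquad z(0)=z_0,$$ the following hold. 1. For every $z_0\in H$ there is a unique mild solution on $[0,\infty)$, i.e. a unique continuous $z:[0,\infty)\to H$ with $$z(t)=S(t)z_0-\int_0^t\langle z(s),Bz(s)\rangle\,S(t-s)Bz(s)\,ds\qquad(t\ge 0).$$ 2. The equilibrium $0$ is Lyapunov stable: for every $\varepsilon>0$ there is $\alpha>0$ such that $\|z_0\|<\alpha$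 implies $\|z(t)\|<\varepsilon$ for all $t\ge 0$. 3. For every $z_0\in H$, $\|z(t)\|\to 0$ as $t\to+\infty$. -/

import Mathlib

open Filter Topology Set

/-- A `C₀`-semigroup `(S(t))_{t ≥ 0}` of bounded linear operators on `H`. The family is indexed by
`ℝ` for convenience; only its values at times `t ≥ 0` are constrained, and only these are used. -/
structure C0Semigroup (𝕜 : Type*) [RCLike 𝕜] (H : Type*) [NormedAddCommGroup H]
    [NormedSpace 𝕜 H] where
  op : ℝ → H →L[𝕜] H
  op_zero : op 0 = ContinuousLinearMap.id 𝕜 H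
  op_add : ∀ s t : ℝ, 0 ≤ s → 0 ≤ t → op (s + t) = (op s).comp (op t)
  tendsto_zero : ∀ x : H, Tendsto (fun t : ℝ => op t x) (𝓝[≥] 0) (𝓝 x)

namespace C0Semigroup

section Basic

variable {𝕜 : Type*} [RCLike 𝕜] {H : Type*} [NormedAddCommGroup H] [NormedSpace 𝕜 H]

/-- The (in general unbounded) operator `A` is the infinitesimal generator of `S`: its domain is
the set of all `x` for which `lim_{h → 0⁺} (S(h)x - x)/h` exists, and `A x` is that limit. -/
def IsGeneratedBy (S : C0Semigroup 𝕜 H) (A : H →ₗ.[𝕜] H) : Prop :=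
  ∀ x y : H, (x, y) ∈ A.graph ↔
    Tendsto (fun h : ℝ => ((h : 𝕜)⁻¹) • (S.op h x - x)) (𝓝[>] 0) (𝓝 y)

/-- `S` is a semigroup of contractions: `‖S(t)‖ ≤ 1` for all `t ≥ 0`. -/
def IsContractive (S : C0Semigroup 𝕜 H) : Prop :=
  ∀ t : ℝ, 0 ≤ t → ‖S.op t‖ ≤ 1

/-- `S` is a compact semigroup: `S(t)` is a compact operator for all `t > 0`. -/
def IsCompactSemigroup (S : C0Semigroup 𝕜 H) : Prop :=
  ∀ t : ℝ, 0 < t → IsCompactOperator (S.op t)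

end Basic

section Evolution

variable {𝕜 : Type*} [RCLike 𝕜] {H : Type*} [NormedAddCommGroup H] [NormedSpace 𝕜 H]
  [NormedSpace ℝ H]

/-- `z` is a (global) mild solution of `z'(t) = A z(t) + F(t, z(t))`, `z(0) = z₀`, where `A`
generates `S`: it is continuous on `[0, ∞)` and satisfies the variation of constants formula
`z(t) = S(t) z₀ + ∫₀ᵗ S(t - s) F(s, z(s)) ds`, the integrand being integrable. -/
def IsMildSolution (S : C0Semigroup 𝕜 H) (F : ℝ → H → H) (z₀ : H) (z : ℝ → H) : Prop :=
  ContinuousOn z (Ici 0) ∧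
    ∀ t : ℝ, 0 ≤ t →
      IntervalIntegrable (fun s => S.op (t - s) (F s (z s))) MeasureTheory.volume 0 t ∧
        z t = S.op t z₀ + ∫ s in (0 : ℝ)..t, S.op (t - s) (F s (z s))

/-- `z'(t) = A z(t) + F(t, z(t))` is strongly stable at the origin: from each initial state there
is a unique solution on `[0, ∞)`, the equilibrium `0` is Lyapunov stable, and every solution
tends to `0` in norm as `t → ∞`. -/
def IsStronglyStable (S : C0Semigroup 𝕜 H) (F : ℝ → H → H) : Prop :=
  (∀ z₀ : H, ∃ z : ℝ → H, S.IsMildSolution F z₀ z ∧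
      ∀ w : ℝ → H, S.IsMildSolution F z₀ w → EqOn w z (Ici 0)) ∧
  (∀ ε : ℝ, 0 < ε → ∃ α : ℝ, 0 < α ∧ ∀ (z₀ : H) (z : ℝ → H), ‖z₀‖ < α →
      S.IsMildSolution F z₀ z → ∀ t : ℝ, 0 ≤ t → ‖z t‖ < ε) ∧
  (∀ (z₀ : H) (z : ℝ → H), S.IsMildSolution F z₀ z → Tendsto z atTop (𝓝 0))

/-- The feedback control `v(t) = V(z(t))` strongly stabilizes the bilinear system
`z'(t) = A z(t) + v(t) B z(t)`, where `A` generates `S`. -/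
def StronglyStabilizes (S : C0Semigroup 𝕜 H) (B : H →L[𝕜] H) (V : H → 𝕜) : Prop :=
  S.IsStronglyStable (fun _ y => V y • B y)

end Evolution

end C0Semigroup

/-- The quadratic feedback `v₀ = -⟨z, B z⟩`. With the convention that `⟨·,·⟩` is linear in its
first argument, `⟨z, B z⟩` is Mathlib's `inner 𝕜 (B z) z` (linear in the second argument). This is
the order for which the energy is decreasing when the scalars are complex; for real scalars the
order does not matter. -/
def quadraticFeedback {𝕜 : Type*} [RCLike 𝕜] {H : Type*} [NormedAddCommGroup H]
    [InnerProductSpace 𝕜 H] (B : H →L[𝕜] H) (z : H) : 𝕜 :=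
  -(inner 𝕜 (B z) z)

/-- Weak observability: if `⟨B S(t) y, S(t) y⟩ = 0` for all `t ≥ 0` then `y = 0`. -/
def WeaklyObservable {𝕜 : Type*} [RCLike 𝕜] {H : Type*} [NormedAddCommGroup H]
    [InnerProductSpace 𝕜 H] (S : C0Semigroup 𝕜 H) (B : H →L[𝕜] H) : Prop :=
  ∀ y : H, (∀ t : ℝ, 0 ≤ t → inner 𝕜 (B (S.op t y)) (S.op t y) = 0) → y = 0

namespace C0Semigroup

/-! ### Contraction semigroups, the variation of constants formula, and globally Lipschitz
perturbations. -/

section Duhamel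

variable {𝕜 : Type*} [RCLike 𝕜] {H : Type*} [NormedAddCommGroup H] [NormedSpace 𝕜 H]

/-! This is a LaSalle argument with energy `‖z‖²`. Pairing the feedback term with `z` gives `-|⟨Bz,
z⟩|²`, and the contraction semigroup only loses energy, so `‖z b‖² + 2 ∫ |⟨Bz, z⟩|² ≤ ‖z a‖²`
(`norm_sq_add_integral_le`). Mild solutions need not be differentiable, so `norm_sq_le` proves this
kind of inequality from a bound on right slopes.

The norm is therefore nonincreasing, which gives Lyapunov stability, and the dissipation over
windows of fixed length tends to zero. On such windows `z` then follows the free semigroup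
(`tendsto_sub_op`), so every sequential limit point at infinity is unobservable, hence zero.
Compactness of `S(1)` supplies a limit point, and monotonicity of the norm upgrades subsequential
convergence to convergence.

For well-posedness, the cubic nonlinearity is composed with a radial truncation. The result is
globally Lipschitz and still dissipative, so its Picard solution never leaves the ball where the
truncation is the identity. -/

lemma IsContractive.norm_op_apply_le {S : C0Semigroup 𝕜 H} (hS : S.IsContractive) {t : ℝ}
    (ht : 0 ≤ t) (x : H) : ‖S.op t x‖ ≤ ‖x‖ := by
  simpa using (S.op t).le_of_opNorm_le (hS t ht) x

/-- The contraction at the earlier time factors out, which reduces continuity at every time, from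
both sides, to right continuity at `0`. -/
lemma IsContractive.norm_op_sub_op_le {S : C0Semigroup 𝕜 H} (hS : S.IsContractive) {s t : ℝ}
    (hs : 0 ≤ s) (ht : 0 ≤ t) (x : H) : ‖S.op t x - S.op s x‖ ≤ ‖S.op |t - s| x - x‖ := by
  wlog hst : s ≤ t generalizing s t
  · rw [norm_sub_rev, abs_sub_comm]
    exact this ht hs (le_of_not_ge hst)
  have h : S.op t x = S.op s (S.op (t - s) x) := by
    have := S.op_add s (t - s) hs (sub_nonneg.2 hst)
    rw [add_sub_cancel] at this
    rw [this]
    rfl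
  rw [h, ← map_sub, abs_of_nonneg (sub_nonneg.2 hst)]
  exact hS.norm_op_apply_le hs _

/-- The orbits of a contraction semigroup, extended by a constant to negative times, are
continuous. -/
lemma IsContractive.continuous_orbit {S : C0Semigroup 𝕜 H} (hS : S.IsContractive) (x : H) :
    Continuous fun t : ℝ => S.op (max t 0) x := by
  rw [continuous_iff_continuousAt]
  intro t
  rw [ContinuousAt, tendsto_iff_norm_sub_tendsto_zero]
  have h1 : Tendsto (fun r : ℝ => |max r 0 - max t 0|) (𝓝 t) (𝓝[≥] 0) := by
    refine tendsto_nhdsWithin_iff.2 ⟨?_, Eventually.of_forall fun r => mem_Ici.2 (abs_nonneg _)⟩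
    have : Continuous fun r : ℝ => |max r 0 - max t 0| := by fun_prop
    simpa using this.tendsto t
  have h2 := (tendsto_iff_norm_sub_tendsto_zero.1 (S.tendsto_zero x)).comp h1
  exact squeeze_zero (fun _ => norm_nonneg _)
    (fun r => hS.norm_op_sub_op_le (le_max_right _ _) (le_max_right _ _) x) h2

/-- Contractivity makes the dependence on the vector uniform in time, so strong continuity becomes
joint continuity. Clamping by `max · 0` avoids negative times, where the family is arbitrary. -/
lemma IsContractive.continuous_op_apply {S : C0Semigroup 𝕜 H} (hS : S.IsContractive)
    {X : Type*} [TopologicalSpace X] {τ : X → ℝ} {f : X → H} (hτ : Continuous τ)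
    (hf : Continuous f) : Continuous fun p => S.op (max (τ p) 0) (f p) := by
  rw [continuous_iff_continuousAt]
  intro p
  have h1 : Tendsto (fun q => S.op (max (τ q) 0) (f q - f p)) (𝓝 p) (𝓝 0) := by
    refine squeeze_zero_norm (fun q => hS.norm_op_apply_le (le_max_right _ _) _) ?_
    exact tendsto_iff_norm_sub_tendsto_zero.1 (hf.tendsto p)
  have h2 : Tendsto (fun q => S.op (max (τ q) 0) (f p)) (𝓝 p) (𝓝 (S.op (max (τ p) 0) (f p))) :=
    ((hS.continuous_orbit (f p)).comp hτ).tendsto p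
  simpa [ContinuousAt] using h1.add h2

lemma IsContractive.intervalIntegrable_op {S : C0Semigroup 𝕜 H} (hS : S.IsContractive)
    {g : ℝ → H} (hg : Continuous g) (t a b : ℝ) :
    IntervalIntegrable (fun s => S.op (max (t - s) 0) (g s)) MeasureTheory.volume a b :=
  (hS.continuous_op_apply (by fun_prop) hg).intervalIntegrable a b

variable [NormedSpace ℝ H]

/-- The right-hand side of the variation of constants formula with forcing term `g`. -/
noncomputable def duhamel (S : C0Semigroup 𝕜 H) (z₀ : H) (g : ℝ → H) (t : ℝ) : H :=
  S.op t z₀ + ∫ s in (0 : ℝ)..t, S.op (max (t - s) 0) (g s)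

lemma duhamel_zero_time (S : C0Semigroup 𝕜 H) (z₀ : H) (g : ℝ → H) : S.duhamel z₀ g 0 = z₀ := by
  simp [duhamel, S.op_zero]

lemma duhamel_congr (S : C0Semigroup 𝕜 H) (z₀ : H) {g₁ g₂ : ℝ → H} {t : ℝ} (ht : 0 ≤ t)
    (h : ∀ s, 0 ≤ s → g₁ s = g₂ s) : S.duhamel z₀ g₁ t = S.duhamel z₀ g₂ t := by
  unfold duhamel
  congr 1
  refine intervalIntegral.integral_congr fun s hs => ?_
  rw [uIcc_of_le ht] at hs
  simp only [h s hs.1]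

lemma IsContractive.continuous_duhamel {S : C0Semigroup 𝕜 H} (hS : S.IsContractive) (z₀ : H)
    {g : ℝ → H} (hg : Continuous g) : Continuous fun t : ℝ => S.duhamel z₀ g (max t 0) := by
  unfold duhamel
  refine (hS.continuous_orbit z₀).add ?_
  refine intervalIntegral.continuous_parametric_intervalIntegral_of_continuous
    (f := fun t s => S.op (max (max t 0 - s) 0) (g s)) ?_ (by fun_prop)
  exact hS.continuous_op_apply (τ := fun p : ℝ × ℝ => max p.1 0 - p.2) (f := fun p => g p.2)
    (by fun_prop) (by fun_prop)

/-- Mild solutions of an autonomous equation, expressed by a continuous extension to `ℝ`. -/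
lemma IsContractive.isMildSolution_iff {S : C0Semigroup 𝕜 H} (hS : S.IsContractive)
    {F : H → H} (hF : Continuous F) (z₀ : H) (z : ℝ → H) :
    S.IsMildSolution (fun _ => F) z₀ z ↔ ContinuousOn z (Ici 0) ∧
      ∀ t : ℝ, 0 ≤ t → z t = S.duhamel z₀ (fun s => F (z (max s 0))) t := by
  refine and_congr_right fun hz => forall₂_congr fun t ht => ?_
  have hz' : Continuous fun s : ℝ => z (max s 0) :=
    hz.comp_continuous (by fun_prop) fun s => mem_Ici.2 (le_max_right _ _)
  have heq : EqOn (fun s => S.op (max (t - s) 0) (F (z (max s 0))))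
      (fun s => S.op (t - s) (F (z s))) (uIcc 0 t) := by
    intro s hs
    rw [uIcc_of_le ht] at hs
    simp only [max_eq_left hs.1, max_eq_left (sub_nonneg.2 hs.2)]
  rw [duhamel, intervalIntegral.integral_congr heq]
  refine and_iff_right ?_
  exact (hS.intervalIntegrable_op (hF.comp hz') t 0 t).congr fun s hs => heq (uIoc_subset_uIcc hs)

/-- By the semigroup law, the formula can be restarted at time `t`. -/
lemma IsContractive.duhamel_add [CompleteSpace H] {S : C0Semigroup 𝕜 H} (hS : S.IsContractive)
    (z₀ : H) {g : ℝ → H} (hg : Continuous g) {t h : ℝ} (ht : 0 ≤ t) (hh : 0 ≤ h) :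
    S.duhamel z₀ g (t + h) = S.op h (S.duhamel z₀ g t) +
      ∫ s in t..t + h, S.op (max (t + h - s) 0) (g s) := by
  unfold duhamel
  rw [map_add, ← ContinuousLinearMap.intervalIntegral_comp_comm _
    (hS.intervalIntegrable_op hg t 0 t), add_comm t h, S.op_add h t hh ht,
    ← intervalIntegral.integral_add_adjacent_intervals (hS.intervalIntegrable_op hg (h + t) 0 t)
      (hS.intervalIntegrable_op hg (h + t) t (h + t)), ← add_assoc]
  congr 2
  refine intervalIntegral.integral_congr fun s hs => ?_
  rw [uIcc_of_le ht] at hs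
  have hs' := sub_nonneg.2 hs.2
  simp only [max_eq_left hs', add_sub_assoc, max_eq_left (add_nonneg hh hs'),
    S.op_add h (t - s) hh hs', ContinuousLinearMap.comp_apply]

/-- Integrating the weight `exp (k s)` gains a factor `1 / k`; this makes the Picard map contract on
the whole half-line at once. -/
lemma IsContractive.norm_integral_op_le {S : C0Semigroup 𝕜 H} (hS : S.IsContractive) {g : ℝ → H}
    {M k t : ℝ} (hM : 0 ≤ M) (hk : 0 < k) (ht : 0 ≤ t)
    (h : ∀ s, 0 ≤ s → ‖g s‖ ≤ M * Real.exp (k * s)) :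
    ‖∫ s in (0 : ℝ)..t, S.op (max (t - s) 0) (g s)‖ ≤ M / k * Real.exp (k * t) := by
  calc _ ≤ ∫ s in (0 : ℝ)..t, M * Real.exp (k * s) := by
        refine intervalIntegral.norm_integral_le_of_norm_le ht ?_
          (Continuous.intervalIntegrable (by fun_prop) _ _)
        refine Eventually.of_forall fun s hs => ?_
        exact (hS.norm_op_apply_le (le_max_right _ _) _).trans (h s hs.1.le)
    _ = M / k * (Real.exp (k * t) - 1) := by
        rw [intervalIntegral.integral_const_mul,
          intervalIntegral.integral_comp_mul_left (fun x => Real.exp x) hk.ne', integral_exp]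
        simp
        field_simp
    _ ≤ M / k * Real.exp (k * t) := by
        gcongr
        linarith

/-- The fixed-point map for a globally Lipschitz equation, acting on bounded continuous functions
after multiplication by the weight `exp (-k t)`. -/
lemma IsContractive.exists_picardMap {S : C0Semigroup 𝕜 H} (hS : S.IsContractive)
    {G : H → H} {K : ℝ} (hK : 0 < K) (hG : ∀ x y, ‖G x - G y‖ ≤ K * ‖x - y‖) (hG0 : G 0 = 0)
    (z₀ : H) : ∃ Ψ : BoundedContinuousFunction ℝ H → BoundedContinuousFunction ℝ H,
      ContractingWith (1 / 2) Ψ ∧ ∀ u t, Ψ u t = Real.exp (-(2 * K * max t 0)) •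
        S.duhamel z₀ (fun s => G (Real.exp (2 * K * max s 0) • u s)) (max t 0) := by
  have hGc : Continuous G := by
    have : LipschitzWith ⟨K, hK.le⟩ G := LipschitzWith.of_dist_le_mul fun x y => by
      rw [dist_eq_norm, dist_eq_norm]
      exact hG x y
    exact this.continuous
  have hg (u : BoundedContinuousFunction ℝ H) :
      Continuous fun s => G (Real.exp (2 * K * max s 0) • u s) :=
    hGc.comp (by have := u.continuous; fun_prop)
  have hbound (u : BoundedContinuousFunction ℝ H) (t : ℝ) :
      ‖Real.exp (-(2 * K * max t 0)) •
        S.duhamel z₀ (fun s => G (Real.exp (2 * K * max s 0) • u s)) (max t 0)‖ ≤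
      ‖z₀‖ + K * ‖u‖ / (2 * K) := by
    have ht := le_max_right t 0
    set τ := max t 0
    have h1 := hS.norm_integral_op_le (g := fun s => G (Real.exp (2 * K * max s 0) • u s))
      (M := K * ‖u‖) (k := 2 * K) (by positivity) (by positivity) ht (by
        intro s hs
        have h2 := hG (Real.exp (2 * K * max s 0) • u s) 0
        rw [hG0, sub_zero, sub_zero, norm_smul, Real.norm_of_nonneg (Real.exp_nonneg _),
          max_eq_left hs] at h2
        rw [max_eq_left hs]
        calc _ ≤ _ := h2
          _ ≤ K * (Real.exp (2 * K * s) * ‖u‖) := by gcongr; exact u.norm_coe_le_norm s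
          _ = _ := by ring)
    rw [norm_smul, Real.norm_of_nonneg (Real.exp_nonneg _), duhamel]
    calc _ ≤ Real.exp (-(2 * K * τ)) *
          (‖z₀‖ + K * ‖u‖ / (2 * K) * Real.exp (2 * K * τ)) := by
            gcongr
            exact (norm_add_le _ _).trans (add_le_add (hS.norm_op_apply_le ht _) h1)
      _ = Real.exp (-(2 * K * τ)) * ‖z₀‖ + K * ‖u‖ / (2 * K) := by
            rw [mul_add, mul_left_comm, ← Real.exp_add]
            simp
      _ ≤ _ := by
            gcongr
            refine mul_le_of_le_one_left (norm_nonneg _) (Real.exp_le_one_iff.2 ?_)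
            have : 0 ≤ 2 * K * τ := by positivity
            linarith
  refine ⟨fun u => BoundedContinuousFunction.ofNormedAddCommGroup _ ?_ _ (hbound u), ?_,
    fun u t => rfl⟩
  · have := hS.continuous_duhamel z₀ (hg u)
    fun_prop
  refine ⟨by norm_num, LipschitzWith.of_dist_le_mul fun u w => ?_⟩
  refine (BoundedContinuousFunction.dist_le (by positivity)).2 fun t => ?_
  simp only [BoundedContinuousFunction.coe_ofNormedAddCommGroup]
  have ht := le_max_right t 0
  set τ := max t 0
  rw [dist_eq_norm, ← smul_sub, norm_smul, Real.norm_of_nonneg (Real.exp_nonneg _), duhamel,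
    duhamel, add_sub_add_left_eq_sub, ← intervalIntegral.integral_sub
      (hS.intervalIntegrable_op (hg u) _ _ _) (hS.intervalIntegrable_op (hg w) _ _ _)]
  simp only [← map_sub]
  -- The weight exponent `2K` turns the Lipschitz constant `K` into `K / (2K) = 1/2`.
  have h1 := hS.norm_integral_op_le
    (g := fun s => G (Real.exp (2 * K * max s 0) • u s) - G (Real.exp (2 * K * max s 0) • w s))
    (M := K * dist u w) (k := 2 * K) (by positivity) (by positivity) ht (by
      intro s hs
      have h2 := hG (Real.exp (2 * K * max s 0) • u s) (Real.exp (2 * K * max s 0) • w s)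
      rw [← smul_sub, norm_smul, Real.norm_of_nonneg (Real.exp_nonneg _), max_eq_left hs] at h2
      rw [max_eq_left hs]
      calc _ ≤ _ := h2
        _ ≤ K * (Real.exp (2 * K * s) * dist u w) := by
            gcongr
            rw [← dist_eq_norm]
            exact BoundedContinuousFunction.dist_coe_le_dist s
        _ = _ := by ring)
  calc _ ≤ Real.exp (-(2 * K * τ)) * (K * dist u w / (2 * K) * Real.exp (2 * K * τ)) := by
        gcongr
    _ = K * dist u w / (2 * K) := by
        rw [mul_left_comm, ← Real.exp_add]
        simp
    _ = _ := by
        push_cast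
        field_simp

lemma IsContractive.exists_solution_of_lipschitz [CompleteSpace H] {S : C0Semigroup 𝕜 H}
    (hS : S.IsContractive) {G : H → H} {K : ℝ} (hK : 0 < K)
    (hG : ∀ x y, ‖G x - G y‖ ≤ K * ‖x - y‖) (hG0 : G 0 = 0) (z₀ : H) :
    ∃ z : ℝ → H, Continuous z ∧ ∀ t, 0 ≤ t → z t = S.duhamel z₀ (fun s => G (z s)) t := by
  obtain ⟨Ψ, hΨ, hΨ'⟩ := hS.exists_picardMap hK hG hG0 z₀
  set u := ContractingWith.fixedPoint Ψ hΨ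
  have hu : Ψ u = u := hΨ.fixedPoint_isFixedPt
  refine ⟨fun t => Real.exp (2 * K * max t 0) • u t, by have := u.continuous; fun_prop, ?_⟩
  intro t ht
  simp only
  nth_rewrite 1 [← hu]
  rw [hΨ', smul_smul, ← Real.exp_add, max_eq_left ht]
  simp

/-- Boundedness places each weighted solution in the space where the Picard map has a unique fixed
point. -/
lemma IsContractive.eqOn_of_lipschitz [CompleteSpace H] {S : C0Semigroup 𝕜 H}
    (hS : S.IsContractive) {G : H → H} {K : ℝ} (hK : 0 < K)
    (hG : ∀ x y, ‖G x - G y‖ ≤ K * ‖x - y‖) (hG0 : G 0 = 0) (z₀ : H) {R : ℝ} {z w : ℝ → H}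
    (hz : Continuous z) (hzR : ∀ t, 0 ≤ t → ‖z t‖ ≤ R)
    (hz' : ∀ t, 0 ≤ t → z t = S.duhamel z₀ (fun s => G (z s)) t)
    (hw : Continuous w) (hwR : ∀ t, 0 ≤ t → ‖w t‖ ≤ R)
    (hw' : ∀ t, 0 ≤ t → w t = S.duhamel z₀ (fun s => G (w s)) t) : EqOn w z (Ici 0) := by
  obtain ⟨Ψ, hΨ, hΨ'⟩ := hS.exists_picardMap hK hG hG0 z₀
  have key (x : ℝ → H) (hx : Continuous x) (hxR : ∀ t, 0 ≤ t → ‖x t‖ ≤ R)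
      (hx' : ∀ t, 0 ≤ t → x t = S.duhamel z₀ (fun s => G (x s)) t) (t : ℝ) (ht : 0 ≤ t) :
      x t = Real.exp (2 * K * t) • ContractingWith.fixedPoint Ψ hΨ t := by
    have hb (t : ℝ) : ‖Real.exp (-(2 * K * max t 0)) • x (max t 0)‖ ≤ R := by
      rw [norm_smul, Real.norm_of_nonneg (Real.exp_nonneg _)]
      refine (mul_le_of_le_one_left (norm_nonneg _) (Real.exp_le_one_iff.2 ?_)).trans
        (hxR _ (le_max_right _ _))
      have : 0 ≤ 2 * K * max t 0 := by positivity
      linarith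
    -- Constant for negative times, as every value of `Ψ` is.
    let u : BoundedContinuousFunction ℝ H :=
      BoundedContinuousFunction.ofNormedAddCommGroup _ (by fun_prop) R hb
    have hu (t : ℝ) : u t = Real.exp (-(2 * K * max t 0)) • x (max t 0) := rfl
    have hfix : Ψ u = u := by
      ext t
      rw [hΨ', hu, hx' _ (le_max_right _ _)]
      congr 1
      refine S.duhamel_congr z₀ (le_max_right _ _) fun s hs => ?_
      rw [hu, smul_smul, ← Real.exp_add, max_eq_left hs]
      simp
    rw [← hΨ.fixedPoint_unique hfix, hu, smul_smul, ← Real.exp_add, max_eq_left ht]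
    simp
  intro t ht
  rw [key z hz hzR hz' t ht, key w hw hwR hw' t ht]

end Duhamel

/-! ### Energy inequality for mild solutions. -/

section Energy

variable {𝕜 : Type*} [RCLike 𝕜] {H : Type*} [NormedAddCommGroup H] [InnerProductSpace 𝕜 H]
  [NormedSpace ℝ H] [IsScalarTower ℝ 𝕜 H] [CompleteSpace H]

open RCLike in
-- To first order `z y` is `S(y - t)` applied to `z t + (y - t) g t`. Keeping the semigroup outside
-- and discarding it by contractivity avoids differentiating the orbit.
lemma IsContractive.eventually_norm_le {S : C0Semigroup 𝕜 H} (hS : S.IsContractive) {z₀ : H}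
    {z g : ℝ → H} (hg : Continuous g) (hzg : ∀ t, 0 ≤ t → z t = S.duhamel z₀ g t) {t ε : ℝ}
    (ht : 0 ≤ t) (hε : 0 < ε) :
    ∀ᶠ y in 𝓝[>] t, ‖z y‖ ≤ ‖z t + ((y - t : ℝ) : 𝕜) • g t‖ + ε * (y - t) := by
  have hcont : Continuous fun p : ℝ × ℝ =>
      S.op (max (p.1 - p.2) 0) (g p.2) - S.op (max (p.1 - t) 0) (g t) :=
    (hS.continuous_op_apply (τ := fun p : ℝ × ℝ => p.1 - p.2) (by fun_prop) (by fun_prop)).sub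
      (hS.continuous_op_apply (τ := fun p : ℝ × ℝ => p.1 - t) (by fun_prop) (by fun_prop))
  obtain ⟨δ, hδ, hδ'⟩ := Metric.continuous_iff.1 hcont (t, t) ε hε
  filter_upwards [Ioo_mem_nhdsGT (show t < t + δ by linarith)] with y hy
  have hh : 0 ≤ y - t := by linarith [hy.1]
  have hrestart := hS.duhamel_add z₀ hg ht hh
  rw [add_sub_cancel, ← hzg y (ht.trans hy.1.le), ← hzg t ht] at hrestart
  have hrest : ‖(∫ s in t..y, S.op (max (y - s) 0) (g s)) -
      S.op (y - t) (((y - t : ℝ) : 𝕜) • g t)‖ ≤ ε * (y - t) := by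
    have h1 : S.op (y - t) (((y - t : ℝ) : 𝕜) • g t) = ∫ _ in t..y, S.op (max (y - t) 0) (g t) := by
      rw [intervalIntegral.integral_const, map_smul, max_eq_left hh, real_smul_eq_coe_smul (K := 𝕜)]
    rw [h1, ← intervalIntegral.integral_sub (hS.intervalIntegrable_op hg y t y) (by simp)]
    refine (intervalIntegral.norm_integral_le_of_norm_le_const fun s hs => ?_).trans_eq
      (by rw [abs_of_nonneg hh])
    rw [uIoc_of_le hy.1.le] at hs
    have h2 := hδ' (y, s) (by
      rw [Prod.dist_eq, max_lt_iff, Real.dist_eq, Real.dist_eq, abs_lt, abs_lt]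
      exact ⟨⟨by linarith [hy.1], by linarith [hy.2]⟩,
        ⟨by linarith [hs.1], by linarith [hs.2, hy.2]⟩⟩)
    simpa [dist_eq_norm] using h2.le
  calc ‖z y‖ = ‖S.op (y - t) (z t + ((y - t : ℝ) : 𝕜) • g t) +
        ((∫ s in t..y, S.op (max (y - s) 0) (g s)) -
          S.op (y - t) (((y - t : ℝ) : 𝕜) • g t))‖ := by
        rw [hrestart, map_add]
        congr 1
        abel
    _ ≤ _ := (norm_add_le _ _).trans (add_le_add (hS.norm_op_apply_le hh _) hrest)

open RCLike in
/-- The energy inequality for mild solutions driven by a contraction semigroup. -/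
lemma IsContractive.norm_sq_le {S : C0Semigroup 𝕜 H} (hS : S.IsContractive) {z₀ : H}
    {z g : ℝ → H} (hz : Continuous z) (hg : Continuous g)
    (hzg : ∀ t, 0 ≤ t → z t = S.duhamel z₀ g t) {a b : ℝ} (ha : 0 ≤ a) (hab : a ≤ b) :
    ‖z b‖ ^ 2 ≤ ‖z a‖ ^ 2 + ∫ s in a..b, 2 * re (inner 𝕜 (z s) (g s)) := by
  have hc : Continuous fun s => 2 * re (inner 𝕜 (z s) (g s)) := by fun_prop
  have hderiv (x : ℝ) : HasDerivAt
      (fun y => ‖z a‖ ^ 2 + ∫ s in a..y, 2 * re (inner 𝕜 (z s) (g s)))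
      (2 * re (inner 𝕜 (z x) (g x))) x :=
    (intervalIntegral.integral_hasDerivAt_right (hc.intervalIntegrable _ _)
      (hc.stronglyMeasurableAtFilter _ _) hc.continuousAt).const_add _
  -- This comparison principle needs only right slopes of `‖z‖²`, not a derivative.
  refine image_le_of_liminf_slope_right_le_deriv_boundary (f := fun t => ‖z t‖ ^ 2)
    (by fun_prop) (by simp) (fun x _ => (hderiv x).continuousAt.continuousWithinAt)
    (fun x _ => (hderiv x).hasDerivWithinAt) ?_ (right_mem_Icc.2 hab)
  intro t ht r hr
  refine Eventually.frequently ?_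
  set D := 2 * re (inner 𝕜 (z t) (g t)) with hD
  -- `ε * h * C` bounds the error terms in the expansion of `(‖z t + h g t‖ + ε h)²` when `h ≤ ε ≤
  -- 1`; `ε` is chosen so that `ε * C` stays below the gap `r - D`.
  set C := ‖g t‖ ^ 2 + 2 * ‖z t‖ + 2 * ‖g t‖ + 1 with hC
  have hCpos : 0 < C := by positivity
  set ε := min 1 ((r - D) / (2 * C)) with hε
  have hεpos : 0 < ε := lt_min one_pos (div_pos (by linarith) (by linarith))
  have hε1 : ε ≤ 1 := min_le_left _ _
  have hεC : ε * C < r - D := by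
    have h1 : ε ≤ (r - D) / (2 * C) := min_le_right _ _
    rw [le_div_iff₀ (by positivity)] at h1
    nlinarith
  filter_upwards [hS.eventually_norm_le hg hzg (ha.trans ht.1) hεpos,
    Ioo_mem_nhdsGT (show t < t + ε by linarith)] with y hy hyε
  obtain ⟨h, rfl⟩ : ∃ h, y = t + h := ⟨y - t, by ring⟩
  have hh : 0 < h := by linarith [hyε.1]
  have hhε : h ≤ ε := by linarith [hyε.2]
  rw [add_sub_cancel_left] at hy
  rw [slope_def_field, add_sub_cancel_left, div_lt_iff₀ hh]
  have hnorm : ‖(h : 𝕜) • g t‖ = h * ‖g t‖ := by rw [norm_smul, norm_ofReal, abs_of_pos hh]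
  have hsq : ‖z t + (h : 𝕜) • g t‖ ^ 2 = ‖z t‖ ^ 2 + h * D + (h * ‖g t‖) ^ 2 := by
    rw [norm_add_sq (𝕜 := 𝕜), hnorm, inner_smul_right, re_ofReal_mul, hD]
    ring
  have hle : ‖z t + (h : 𝕜) • g t‖ ≤ ‖z t‖ + ‖g t‖ := by
    refine (norm_add_le _ _).trans (add_le_add_right ?_ _)
    rw [hnorm]
    exact mul_le_of_le_one_left (norm_nonneg _) (hhε.trans hε1)
  have h1 : ‖z (t + h)‖ ^ 2 ≤ (‖z t + (h : 𝕜) • g t‖ + ε * h) ^ 2 := by gcongr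
  have h2 : 2 * (ε * h) * ‖z t + (h : 𝕜) • g t‖ ≤ 2 * (ε * h) * (‖z t‖ + ‖g t‖) := by gcongr
  have h3 : h * h * ‖g t‖ ^ 2 ≤ ε * h * ‖g t‖ ^ 2 := by gcongr
  have h4 : ε * h * (ε * h) ≤ ε * h * (1 * 1) := by gcongr; exact hhε.trans hε1
  have h5 : ε * C * h < (r - D) * h := by gcongr
  have h6 : ε * C * h = ε * h * ‖g t‖ ^ 2 + 2 * (ε * h) * (‖z t‖ + ‖g t‖) + ε * h * (1 * 1) := by
    rw [hC]
    ring
  linarith [add_sq ‖z t + (h : 𝕜) • g t‖ (ε * h)]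

end Energy

end C0Semigroup

/-! ### Radial truncation. -/

section RadialTruncation

variable (𝕜 : Type*) [RCLike 𝕜] {H : Type*} [NormedAddCommGroup H] [NormedSpace 𝕜 H]

/-- The radial retraction of `H` onto the closed ball of radius `R`. -/
noncomputable def radialTruncation (R : ℝ) (x : H) : H := ((R / max R ‖x‖ : ℝ) : 𝕜) • x

variable {R : ℝ}

lemma radialTruncation_of_norm_le (hR : 0 < R) {x : H} (hx : ‖x‖ ≤ R) :
    radialTruncation 𝕜 R x = x := by
  rw [radialTruncation, max_eq_left hx, div_self hR.ne', RCLike.ofReal_one, one_smul]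

lemma norm_radialTruncation_le (hR : 0 < R) (x : H) : ‖radialTruncation 𝕜 R x‖ ≤ R := by
  have hm : 0 < max R ‖x‖ := hR.trans_le (le_max_left _ _)
  rw [radialTruncation, norm_smul, RCLike.norm_ofReal, abs_of_pos (div_pos hR hm), div_mul_eq_mul_div,
    div_le_iff₀ hm]
  gcongr
  exact le_max_right _ _

/-- Moving the vector and changing the scaling factor each cost at most `‖x - y‖`. -/
lemma norm_radialTruncation_sub_le (hR : 0 < R) (x y : H) :
    ‖radialTruncation 𝕜 R x - radialTruncation 𝕜 R y‖ ≤ 2 * ‖x - y‖ := by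
  have ha : 0 < max R ‖x‖ := hR.trans_le (le_max_left _ _)
  have hb : 0 < max R ‖y‖ := hR.trans_le (le_max_left _ _)
  have hab : |max R ‖y‖ - max R ‖x‖| ≤ ‖x - y‖ := by
    refine (abs_max_sub_max_le_max R ‖y‖ R ‖x‖).trans (max_le (by simp) ?_)
    rw [norm_sub_rev]
    exact abs_norm_sub_norm_le y x
  have hya : ‖y‖ ≤ max R ‖y‖ := le_max_right _ _
  have hRa : R ≤ max R ‖x‖ := le_max_left _ _
  unfold radialTruncation
  set a := max R ‖x‖
  set b := max R ‖y‖
  have h : ((R / a : ℝ) : 𝕜) • x - ((R / b : ℝ) : 𝕜) • y =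
      ((R / a : ℝ) : 𝕜) • (x - y) + ((R / a - R / b : ℝ) : 𝕜) • y := by
    rw [RCLike.ofReal_sub, smul_sub, sub_smul]
    abel
  have h1 : R / a ≤ 1 := (div_le_one ha).2 hRa
  have h2 : R / a - R / b = R / a * ((b - a) / b) := by
    field_simp
  rw [h]
  refine (norm_add_le _ _).trans ?_
  rw [norm_smul, norm_smul, RCLike.norm_ofReal, RCLike.norm_ofReal, h2, abs_mul,
    abs_of_pos (div_pos hR ha), abs_div, abs_of_pos hb]
  have h3 : R / a * (|b - a| / b) * ‖y‖ ≤ 1 * ‖x - y‖ := by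
    rw [mul_assoc]
    refine mul_le_mul h1 ?_ (by positivity) zero_le_one
    rw [div_mul_eq_mul_div, div_le_iff₀ hb]
    gcongr
  have h4 : R / a * ‖x - y‖ ≤ 1 * ‖x - y‖ := by gcongr
  linarith

end RadialTruncation

/-! ### Algebra and Lipschitz bounds of the cubic feedback term. -/

section Feedback

variable {𝕜 : Type*} [RCLike 𝕜] {H : Type*} [NormedAddCommGroup H] [InnerProductSpace 𝕜 H]

open RCLike

lemma continuous_quadraticFeedback_smul (B : H →L[𝕜] H) :
    Continuous fun y => quadraticFeedback B y • B y := by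
  unfold quadraticFeedback
  fun_prop

/-- The order in the feedback yields a number times its own conjugate; the opposite order would
yield a square, whose real part has no sign over `ℂ`. -/
lemma re_inner_quadraticFeedback_smul (B : H →L[𝕜] H) (y : H) :
    re (inner 𝕜 y (quadraticFeedback B y • B y)) = -‖(inner 𝕜 (B y) y : 𝕜)‖ ^ 2 := by
  rw [quadraticFeedback, inner_smul_right, neg_mul, ← inner_conj_symm y (B y), RCLike.mul_conj,
    map_neg, ← ofReal_pow, ofReal_re]

lemma quadraticFeedback_smul_ofReal_smul (B : H →L[𝕜] H) (c : ℝ) (y : H) :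
    quadraticFeedback B ((c : 𝕜) • y) • B ((c : 𝕜) • y) =
      ((c ^ 3 : ℝ) : 𝕜) • (quadraticFeedback B y • B y) := by
  simp only [quadraticFeedback, map_smul, inner_smul_left, inner_smul_right, smul_smul, conj_ofReal]
  congr 1
  push_cast
  ring

lemma norm_inner_map_le (B : H →L[𝕜] H) (x y : H) :
    ‖(inner 𝕜 (B x) y : 𝕜)‖ ≤ ‖B‖ * ‖x‖ * ‖y‖ :=
  (norm_inner_le_norm _ _).trans (by gcongr; exact B.le_opNorm x)

lemma norm_quadraticFeedback_smul_sub_le (B : H →L[𝕜] H) {R : ℝ} (hR : 0 ≤ R) {x y : H}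
    (hx : ‖x‖ ≤ R) (hy : ‖y‖ ≤ R) :
    ‖quadraticFeedback B x • B x - quadraticFeedback B y • B y‖ ≤
      3 * ‖B‖ ^ 2 * R ^ 2 * ‖x - y‖ := by
  -- The three occurrences of the vector are changed one at a time, whence the constant `3`.
  have h : quadraticFeedback B x • B x - quadraticFeedback B y • B y =
      -((inner 𝕜 (B x) x : 𝕜) • B (x - y) +
        ((inner 𝕜 (B x) (x - y) : 𝕜) + inner 𝕜 (B (x - y)) y) • B y) := by
    simp only [quadraticFeedback, map_sub, inner_sub_left, inner_sub_right]
    module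
  rw [h, norm_neg]
  calc _ ≤ ‖B‖ * R * R * (‖B‖ * ‖x - y‖) +
        (‖B‖ * R * ‖x - y‖ + ‖B‖ * ‖x - y‖ * R) * (‖B‖ * R) := by
        refine (norm_add_le _ _).trans ?_
        rw [norm_smul, norm_smul]
        gcongr
        · exact (norm_inner_map_le B x x).trans (by gcongr)
        · exact B.le_opNorm _
        · refine (norm_add_le _ _).trans ?_
          gcongr
          · exact (norm_inner_map_le B x (x - y)).trans (by gcongr)
          · exact (norm_inner_map_le B (x - y) y).trans (by gcongr)
        · exact (B.le_opNorm y).trans (by gcongr)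
    _ = _ := by ring

lemma norm_quadraticFeedback_smul_radialTruncation_sub_le (B : H →L[𝕜] H) {R : ℝ} (hR : 0 < R)
    (x y : H) :
    ‖quadraticFeedback B (radialTruncation 𝕜 R x) • B (radialTruncation 𝕜 R x) -
        quadraticFeedback B (radialTruncation 𝕜 R y) • B (radialTruncation 𝕜 R y)‖ ≤
      (6 * ‖B‖ ^ 2 * R ^ 2 + 1) * ‖x - y‖ := by
  -- The `+ 1` in the constant keeps it positive when `B = 0`, as the Picard map requires.
  calc _ ≤ 3 * ‖B‖ ^ 2 * R ^ 2 * (2 * ‖x - y‖) :=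
        (norm_quadraticFeedback_smul_sub_le B hR.le (norm_radialTruncation_le 𝕜 hR x)
          (norm_radialTruncation_le 𝕜 hR y)).trans
          (by gcongr; exact norm_radialTruncation_sub_le 𝕜 hR x y)
    _ ≤ _ := by linarith [norm_nonneg (x - y)]

/-- Truncation is a nonnegative rescaling, so by cubic homogeneity the dissipative term is only
multiplied by a nonnegative factor. -/
lemma re_inner_quadraticFeedback_smul_radialTruncation_nonpos (B : H →L[𝕜] H) {R : ℝ}
    (hR : 0 < R) (y : H) : re (inner 𝕜 y
      (quadraticFeedback B (radialTruncation 𝕜 R y) • B (radialTruncation 𝕜 R y))) ≤ 0 := by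
  have hc : 0 ≤ R / max R ‖y‖ := by positivity
  rw [radialTruncation, quadraticFeedback_smul_ofReal_smul, inner_smul_right, re_ofReal_mul,
    re_inner_quadraticFeedback_smul]
  exact mul_nonpos_of_nonneg_of_nonpos (by positivity) (by simp)

end Feedback

namespace C0Semigroup

/-! ### Well-posedness, dissipation and asymptotics of the closed loop. -/

section ClosedLoop

variable {𝕜 : Type*} [RCLike 𝕜] {H : Type*} [NormedAddCommGroup H] [InnerProductSpace 𝕜 H]
  [NormedSpace ℝ H] [IsScalarTower ℝ 𝕜 H] [CompleteSpace H]

/-- The closed-loop energy inequality, for continuous `z` solving the integrated equation. -/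
lemma IsContractive.norm_sq_add_integral_le {S : C0Semigroup 𝕜 H} (hS : S.IsContractive)
    {B : H →L[𝕜] H} {z₀ : H} {z : ℝ → H} (hz : Continuous z)
    (hzg : ∀ t, 0 ≤ t → z t = S.duhamel z₀ (fun s => quadraticFeedback B (z s) • B (z s)) t)
    {a b : ℝ} (ha : 0 ≤ a) (hab : a ≤ b) :
    ‖z b‖ ^ 2 + 2 * ∫ s in a..b, ‖(inner 𝕜 (B (z s)) (z s) : 𝕜)‖ ^ 2 ≤ ‖z a‖ ^ 2 := by
  have h := hS.norm_sq_le hz ((continuous_quadraticFeedback_smul B).comp hz) hzg ha hab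
  simp only [Function.comp_apply, re_inner_quadraticFeedback_smul, mul_neg,
    intervalIntegral.integral_neg, intervalIntegral.integral_const_mul] at h
  linarith

lemma IsContractive.norm_le_of_le {S : C0Semigroup 𝕜 H} (hS : S.IsContractive)
    {B : H →L[𝕜] H} {z₀ : H} {z : ℝ → H} (hz : Continuous z)
    (hzg : ∀ t, 0 ≤ t → z t = S.duhamel z₀ (fun s => quadraticFeedback B (z s) • B (z s)) t)
    {a b : ℝ} (ha : 0 ≤ a) (hab : a ≤ b) : ‖z b‖ ≤ ‖z a‖ := by
  have h := hS.norm_sq_add_integral_le hz hzg ha hab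
  have h0 : 0 ≤ ∫ s in a..b, ‖(inner 𝕜 (B (z s)) (z s) : 𝕜)‖ ^ 2 :=
    intervalIntegral.integral_nonneg hab fun _ _ => by positivity
  exact le_of_sq_le_sq (by linarith) (norm_nonneg _)

lemma IsContractive.norm_le_norm_init {S : C0Semigroup 𝕜 H} (hS : S.IsContractive)
    {B : H →L[𝕜] H} {z₀ : H} {z : ℝ → H} (hz : Continuous z)
    (hzg : ∀ t, 0 ≤ t → z t = S.duhamel z₀ (fun s => quadraticFeedback B (z s) • B (z s)) t)
    {t : ℝ} (ht : 0 ≤ t) : ‖z t‖ ≤ ‖z₀‖ := by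
  have h := hS.norm_le_of_le hz hzg le_rfl ht
  rwa [hzg 0 le_rfl, duhamel_zero_time] at h

lemma IsContractive.exists_closedLoop {S : C0Semigroup 𝕜 H} (hS : S.IsContractive)
    (B : H →L[𝕜] H) (z₀ : H) : ∃ z : ℝ → H, Continuous z ∧
      ∀ t, 0 ≤ t → z t = S.duhamel z₀ (fun s => quadraticFeedback B (z s) • B (z s)) t := by
  have hR : 0 < ‖z₀‖ + 1 := by positivity
  obtain ⟨z, hz, hzg⟩ := hS.exists_solution_of_lipschitz (by positivity)
    (norm_quadraticFeedback_smul_radialTruncation_sub_le B hR)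
    (by simp [radialTruncation]) z₀
  refine ⟨z, hz, fun t ht => (hzg t ht).trans (S.duhamel_congr z₀ ht fun s hs => ?_)⟩
  have hP : Continuous (radialTruncation 𝕜 (‖z₀‖ + 1) : H → H) := by
    have : LipschitzWith 2 (radialTruncation 𝕜 (‖z₀‖ + 1) : H → H) :=
      LipschitzWith.of_dist_le_mul fun x y => by
        rw [dist_eq_norm, dist_eq_norm]
        exact norm_radialTruncation_sub_le 𝕜 hR x y
    exact this.continuous
  have hnorm := hS.norm_sq_le hz ((continuous_quadraticFeedback_smul B).comp (hP.comp hz)) hzg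
    le_rfl hs
  have hint := intervalIntegral.integral_mono_on (g := fun _ => (0 : ℝ)) hs
    (Continuous.intervalIntegrable (μ := MeasureTheory.volume) (by
      have := (continuous_quadraticFeedback_smul B).comp (hP.comp hz)
      fun_prop) _ _) (by simp) fun x _ => mul_nonpos_of_nonneg_of_nonpos zero_le_two
        (re_inner_quadraticFeedback_smul_radialTruncation_nonpos B hR (z x))
  rw [intervalIntegral.integral_zero] at hint
  rw [hzg 0 le_rfl, duhamel_zero_time] at hnorm
  have hzs : ‖z s‖ ≤ ‖z₀‖ :=
    le_of_sq_le_sq (hnorm.trans (add_le_of_nonpos_right hint)) (norm_nonneg _)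
  rw [radialTruncation_of_norm_le 𝕜 hR (by linarith)]

/-- The a priori bound by `‖z₀‖` holds for every solution, so both solve the same truncated,
globally Lipschitz equation. -/
lemma IsContractive.closedLoop_unique {S : C0Semigroup 𝕜 H} (hS : S.IsContractive)
    (B : H →L[𝕜] H) (z₀ : H) {z w : ℝ → H} (hz : Continuous z)
    (hzg : ∀ t, 0 ≤ t → z t = S.duhamel z₀ (fun s => quadraticFeedback B (z s) • B (z s)) t)
    (hw : Continuous w)
    (hwg : ∀ t, 0 ≤ t → w t = S.duhamel z₀ (fun s => quadraticFeedback B (w s) • B (w s)) t) :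
    EqOn w z (Ici 0) := by
  have hR : 0 < ‖z₀‖ + 1 := by positivity
  have key (x : ℝ → H) (hx : Continuous x) (hxg : ∀ t, 0 ≤ t →
      x t = S.duhamel z₀ (fun s => quadraticFeedback B (x s) • B (x s)) t) (t : ℝ) (ht : 0 ≤ t) :
      x t = S.duhamel z₀ (fun s => quadraticFeedback B (radialTruncation 𝕜 (‖z₀‖ + 1) (x s)) •
        B (radialTruncation 𝕜 (‖z₀‖ + 1) (x s))) t := by
    refine (hxg t ht).trans (S.duhamel_congr z₀ ht fun s hs => ?_)
    rw [radialTruncation_of_norm_le 𝕜 hR]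
    linarith [hS.norm_le_norm_init hx hxg hs]
  exact hS.eqOn_of_lipschitz (by positivity)
    (norm_quadraticFeedback_smul_radialTruncation_sub_le B hR) (by simp [radialTruncation]) z₀
    hz (fun t => hS.norm_le_norm_init hz hzg) (key z hz hzg)
    hw (fun t => hS.norm_le_norm_init hw hwg) (key w hw hwg)

/-- The energy is nonincreasing and nonnegative, so it converges, and its shift has the same limit.
-/
lemma IsContractive.tendsto_norm_sq_sub {S : C0Semigroup 𝕜 H} (hS : S.IsContractive)
    {B : H →L[𝕜] H} {z₀ : H} {z : ℝ → H} (hz : Continuous z)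
    (hzg : ∀ t, 0 ≤ t → z t = S.duhamel z₀ (fun s => quadraticFeedback B (z s) • B (z s)) t)
    (τ : ℝ) : Tendsto (fun t => ‖z t‖ ^ 2 - ‖z (t + τ)‖ ^ 2) atTop (𝓝 0) := by
  have hanti : Antitone fun t => ‖z (max t 0)‖ ^ 2 := fun a b hab => by
    have := hS.norm_le_of_le hz hzg (le_max_right a 0) (max_le_max_right 0 hab)
    exact pow_le_pow_left₀ (norm_nonneg _) this 2
  have h1 := tendsto_atTop_ciInf hanti ⟨0, by rintro _ ⟨t, rfl⟩; positivity⟩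
  have h2 := h1.sub (h1.comp (tendsto_atTop_add_const_right atTop τ tendsto_id))
  rw [sub_self] at h2
  refine h2.congr' ?_
  filter_upwards [eventually_ge_atTop 0, eventually_ge_atTop (-τ)] with t h3 h4
  simp only [Function.comp_apply, id]
  rw [max_eq_left h3, max_eq_left (by linarith)]

lemma IsContractive.tendsto_integral_norm_sq {S : C0Semigroup 𝕜 H} (hS : S.IsContractive)
    {B : H →L[𝕜] H} {z₀ : H} {z : ℝ → H} (hz : Continuous z)
    (hzg : ∀ t, 0 ≤ t → z t = S.duhamel z₀ (fun s => quadraticFeedback B (z s) • B (z s)) t)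
    {τ : ℝ} (hτ : 0 ≤ τ) : Tendsto (fun t => ∫ s in t..t + τ, ‖(inner 𝕜 (B (z s)) (z s) : 𝕜)‖ ^ 2)
      atTop (𝓝 0) := by
  refine squeeze_zero' (Eventually.of_forall fun t => intervalIntegral.integral_nonneg
    (by linarith) fun _ _ => by positivity) ?_ (hS.tendsto_norm_sq_sub hz hzg τ)
  filter_upwards [eventually_ge_atTop 0] with t ht
  have h := hS.norm_sq_add_integral_le hz hzg ht (le_add_of_nonneg_right hτ)
  have h0 : 0 ≤ ∫ s in t..t + τ, ‖(inner 𝕜 (B (z s)) (z s) : 𝕜)‖ ^ 2 :=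
    intervalIntegral.integral_nonneg (by linarith) fun _ _ => by positivity
  linarith

/-- Over bounded time windows, the closed-loop trajectory asymptotically follows the free
semigroup. -/
lemma IsContractive.tendsto_sub_op {S : C0Semigroup 𝕜 H} (hS : S.IsContractive)
    {B : H →L[𝕜] H} {z₀ : H} {z : ℝ → H} (hz : Continuous z)
    (hzg : ∀ t, 0 ≤ t → z t = S.duhamel z₀ (fun s => quadraticFeedback B (z s) • B (z s)) t)
    {τ : ℝ} (hτ : 0 ≤ τ) : Tendsto (fun t => z (t + τ) - S.op τ (z t)) atTop (𝓝 0) := by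
  rw [Metric.tendsto_nhds]
  intro ε hε
  set C := ‖B‖ * ‖z₀‖ + 1 with hC
  have hCpos : 0 < C := by positivity
  -- Young's inequality `v ≤ η / 2 + v² / η` stands in for Cauchy–Schwarz. This `η` makes `C * η *
  -- (τ + 1) = ε / 2`, and the small window dissipation supplies the other half.
  set η := ε / (2 * C * (τ + 1)) with hη
  have hηpos : 0 < η := by positivity
  have hev := (hS.tendsto_integral_norm_sq hz hzg hτ).eventually
    (gt_mem_nhds (show 0 < η * (ε / (2 * C)) by positivity))
  filter_upwards [hev, eventually_ge_atTop 0] with t ht ht0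
  have hrestart := hS.duhamel_add z₀ ((continuous_quadraticFeedback_smul B).comp hz) ht0 hτ
  have e1 := hzg (t + τ) (by linarith)
  have e2 := hzg t ht0
  simp only [Function.comp_def] at hrestart
  rw [← e1, ← e2] at hrestart
  rw [dist_zero_right, hrestart, add_sub_cancel_left]
  have hle : t ≤ t + τ := by linarith
  calc _ ≤ ∫ s in t..t + τ, C * (η / 2 + ‖(inner 𝕜 (B (z s)) (z s) : 𝕜)‖ ^ 2 / η) := by
        refine intervalIntegral.norm_integral_le_of_norm_le hle
          (Eventually.of_forall fun s hs => ?_) (Continuous.intervalIntegrable (by fun_prop) _ _)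
        refine (hS.norm_op_apply_le (le_max_right _ _) _).trans ?_
        have hBz : ‖B (z s)‖ ≤ C := by
          refine (B.le_opNorm _).trans ?_
          have := hS.norm_le_norm_init hz hzg (ht0.trans hs.1.le)
          have : ‖B‖ * ‖z s‖ ≤ ‖B‖ * ‖z₀‖ := by gcongr
          linarith
        rw [norm_smul, quadraticFeedback, norm_neg, mul_comm]
        set v := ‖(inner 𝕜 (B (z s)) (z s) : 𝕜)‖
        have hv : v ≤ η / 2 + v ^ 2 / η := by
          rw [← sub_nonneg, show η / 2 + v ^ 2 / η - v = ((v - η / 2) ^ 2 + η ^ 2 / 4) / η by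
            field_simp; ring]
          positivity
        gcongr
    _ = C * (η / 2 * τ + (∫ s in t..t + τ, ‖(inner 𝕜 (B (z s)) (z s) : 𝕜)‖ ^ 2) / η) := by
        rw [intervalIntegral.integral_const_mul, intervalIntegral.integral_add (by simp)
          (Continuous.intervalIntegrable (by fun_prop) _ _), intervalIntegral.integral_const,
          intervalIntegral.integral_div, smul_eq_mul, add_sub_cancel_left, mul_comm τ]
    _ < C * (η * (τ + 1) + ε / (2 * C)) := by
        have h1 : (∫ s in t..t + τ, ‖(inner 𝕜 (B (z s)) (z s) : 𝕜)‖ ^ 2) / η < ε / (2 * C) := by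
          rw [div_lt_iff₀ hηpos]
          linarith
        have h2 : η / 2 * τ ≤ η * (τ + 1) := by nlinarith
        exact mul_lt_mul_of_pos_left (add_lt_add_of_le_of_lt h2 h1) hCpos
    _ = ε := by
        rw [hη]
        field_simp
        ring

/-- Any limit point of a closed-loop trajectory along a sequence of times tending to infinity is
unobservable. -/
lemma IsContractive.inner_op_eq_zero_of_tendsto {S : C0Semigroup 𝕜 H} (hS : S.IsContractive)
    {B : H →L[𝕜] H} {z₀ : H} {z : ℝ → H} (hz : Continuous z)
    (hzg : ∀ t, 0 ≤ t → z t = S.duhamel z₀ (fun s => quadraticFeedback B (z s) • B (z s)) t)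
    {θ : ℕ → ℝ} (hθ : Tendsto θ atTop atTop) {y : H} (hy : Tendsto (z ∘ θ) atTop (𝓝 y))
    {t : ℝ} (ht : 0 ≤ t) : inner 𝕜 (B (S.op t y)) (S.op t y) = 0 := by
  have hzτ (τ : ℝ) (hτ : 0 ≤ τ) : Tendsto (fun n => z (θ n + τ)) atTop (𝓝 (S.op τ y)) := by
    have h1 := (hS.tendsto_sub_op hz hzg hτ).comp hθ
    have h2 := h1.add (((S.op τ).continuous.tendsto y).comp hy)
    simpa [Function.comp_def] using h2
  have hq : Continuous fun x : H => ‖(inner 𝕜 (B x) x : 𝕜)‖ ^ 2 := by fun_prop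
  -- The window ends at `t + 1` so that it is nondegenerate even for `t = 0`.
  have hlim : Tendsto (fun n => ∫ s in (0 : ℝ)..t + 1,
      ‖(inner 𝕜 (B (z (θ n + s))) (z (θ n + s)) : 𝕜)‖ ^ 2) atTop
      (𝓝 (∫ s in (0 : ℝ)..t + 1,
        ‖(inner 𝕜 (B (S.op (max s 0) y)) (S.op (max s 0) y) : 𝕜)‖ ^ 2)) := by
    refine intervalIntegral.tendsto_integral_filter_of_dominated_convergence
      (fun _ => (‖B‖ * ‖z₀‖ * ‖z₀‖) ^ 2) ?_ ?_ (by simp) ?_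
    · exact Eventually.of_forall fun n =>
        (Continuous.aestronglyMeasurable (by fun_prop))
    · filter_upwards [hθ.eventually (eventually_ge_atTop 0)] with n hn
      refine Eventually.of_forall fun s hs => ?_
      rw [uIoc_of_le (by linarith)] at hs
      have h1 := hS.norm_le_norm_init hz hzg (add_nonneg hn hs.1.le)
      rw [Real.norm_of_nonneg (by positivity)]
      gcongr
      exact (norm_inner_map_le B _ _).trans (by gcongr)
    · refine Eventually.of_forall fun s hs => ?_
      rw [uIoc_of_le (by linarith)] at hs
      rw [max_eq_left hs.1.le]
      exact (hq.tendsto _).comp (hzτ s hs.1.le)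
  have hlim0 : Tendsto (fun n => ∫ s in (0 : ℝ)..t + 1,
      ‖(inner 𝕜 (B (z (θ n + s))) (z (θ n + s)) : 𝕜)‖ ^ 2) atTop (𝓝 0) := by
    have h1 := (hS.tendsto_integral_norm_sq hz hzg (show 0 ≤ t + 1 by linarith)).comp hθ
    refine h1.congr fun n => ?_
    rw [intervalIntegral.integral_comp_add_left
      (fun s => ‖(inner 𝕜 (B (z s)) (z s) : 𝕜)‖ ^ 2) (θ n), add_zero]
    rfl
  have hzero := tendsto_nhds_unique hlim hlim0
  -- A continuous nonnegative function with zero integral vanishes at each point of the window, in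
  -- particular at `t`.
  by_contra hne
  have horb := hS.continuous_orbit y
  refine (intervalIntegral.integral_pos (show 0 < t + 1 by linarith)
    (hq.comp horb).continuousOn (fun _ _ => by simp only [Function.comp_apply]; positivity)
    ⟨t, ⟨ht, by linarith⟩, ?_⟩).ne' hzero
  simp only [Function.comp_apply, max_eq_left ht]
  positivity

/-- The bounded trajectory has relatively compact image under `S(1)`, and `z (n + 1)` is asymptotic
to `S(1) z(n)`; this yields a limit point, which observability forces to be `0`. -/
lemma IsContractive.tendsto_closedLoop {S : C0Semigroup 𝕜 H} (hS : S.IsContractive)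
    (hcomp : S.IsCompactSemigroup) {B : H →L[𝕜] H} (hobs : WeaklyObservable S B)
    {z₀ : H} {z : ℝ → H} (hz : Continuous z)
    (hzg : ∀ t, 0 ≤ t → z t = S.duhamel z₀ (fun s => quadraticFeedback B (z s) • B (z s)) t) :
    Tendsto z atTop (𝓝 0) := by
  obtain ⟨K, hK, hKsub⟩ := IsCompactOperator.image_closedBall_subset_compact
    (f := (S.op 1 : H →ₗ[𝕜] H)) (hcomp 1 one_pos) ‖z₀‖
  obtain ⟨y, -, φ, hφ, hy⟩ := hK.tendsto_subseq (x := fun n : ℕ => S.op 1 (z n)) fun n =>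
    hKsub ⟨z n, by simpa using hS.norm_le_norm_init hz hzg n.cast_nonneg, rfl⟩
  have hφ' : Tendsto (fun n => (φ n : ℝ)) atTop atTop :=
    tendsto_natCast_atTop_atTop.comp hφ.tendsto_atTop
  have hy' : Tendsto (z ∘ fun n => (φ n : ℝ) + 1) atTop (𝓝 y) := by
    have h1 := ((hS.tendsto_sub_op hz hzg zero_le_one).comp hφ').add hy
    simpa [Function.comp_def] using h1
  have hy0 : y = 0 := hobs y fun t ht => hS.inner_op_eq_zero_of_tendsto hz hzg
    (tendsto_atTop_add_const_right atTop 1 hφ') hy' ht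
  rw [hy0, Metric.tendsto_atTop] at hy'
  rw [Metric.tendsto_atTop]
  intro ε hε
  -- One time with norm below `ε` suffices, since the norm never increases afterwards.
  obtain ⟨N, hN⟩ := hy' ε hε
  refine ⟨(φ N : ℝ) + 1, fun t ht => ?_⟩
  have h1 := hN N le_rfl
  rw [dist_zero_right] at h1 ⊢
  exact (hS.norm_le_of_le hz hzg (by positivity) ht).trans_lt h1

end ClosedLoop

end C0Semigroup

theorem mainTheorem9 {𝕜 : Type*} [RCLike 𝕜] {H : Type*} [NormedAddCommGroup H]
    [InnerProductSpace 𝕜 H] [NormedSpace ℝ H] [IsScalarTower ℝ 𝕜 H] [CompleteSpace H]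
    (A : H →ₗ.[𝕜] H) (S : C0Semigroup 𝕜 H) (hA : S.IsGeneratedBy A)
    (hcontr : S.IsContractive) (hcomp : S.IsCompactSemigroup)
    (B : H →L[𝕜] H) (hobs : WeaklyObservable S B) :
    S.StronglyStabilizes B (quadraticFeedback B) := by
  have hF := continuous_quadraticFeedback_smul B
  -- Mild solutions are constrained only on `[0, ∞)`; freezing them at negative times gives the
  -- globally continuous functions used above.
  have key {z₀ : H} {z : ℝ → H}
      (h : S.IsMildSolution (fun _ y => quadraticFeedback B y • B y) z₀ z) :
      (Continuous fun t => z (max t 0)) ∧ ∀ t, 0 ≤ t → z (max t 0) = S.duhamel z₀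
        (fun s => quadraticFeedback B (z (max s 0)) • B (z (max s 0))) t := by
    obtain ⟨hz, hzg⟩ := (hcontr.isMildSolution_iff hF z₀ z).1 h
    exact ⟨hz.comp_continuous (by fun_prop) fun s => mem_Ici.2 (le_max_right _ _),
      fun t ht => by rw [max_eq_left ht]; exact hzg t ht⟩
  refine ⟨fun z₀ => ?_, fun ε hε => ⟨ε, hε, fun z₀ z hz₀ h t ht => ?_⟩, fun z₀ z h => ?_⟩
  · obtain ⟨z, hz, hzg⟩ := hcontr.exists_closedLoop B z₀
    refine ⟨z, (hcontr.isMildSolution_iff hF z₀ z).2 ⟨hz.continuousOn, fun t ht =>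
      (hzg t ht).trans (S.duhamel_congr z₀ ht fun s hs => by rw [max_eq_left hs])⟩, ?_⟩
    intro w hw t ht
    have h := hcontr.closedLoop_unique B z₀ hz hzg (key hw).1 (key hw).2 ht
    simpa only [max_eq_left (mem_Ici.1 ht)] using h
  · have h1 := hcontr.norm_le_norm_init (key h).1 (key h).2 ht
    rw [max_eq_left ht] at h1
    exact h1.trans_lt hz₀
  · refine (hcontr.tendsto_closedLoop hcomp hobs (key h).1 (key h).2).congr' ?_
    filter_upwards [eventually_ge_atTop 0] with t ht
    rw [max_eq_left ht]
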